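/- Let $F_n$ be the free group on $n\ge 2$ generators $S=\{s_1,\dots,s_n\}$. For each integer $L\geq 1$ let $C_L\subset F_n$ be the (finite, nonempty) set of elements represented by cyclically reduced words of length $L$, that is, reduced words of length $L$ whose last letter is not the inverse of the first letter. For $0<d<1$, a random group at density $d$ and length $L$, in the model with cyclically reduced relators, is the group presented by $\langle S\mid R\rangle$, where $R$ is a $\lfloor (2n-1)^{dL}\rfloor$-tuple of elements of $C_L$ chosen uniformly at random among all such tuples (so the relators are independent and uniform, and repetitions are allowed). A group $G$ satisfies property $\mathrm{(FA)}$ if every action of $G$ by automorphisms, without inversions of edges, on a simplicial tree fixes a vertex. **Theorem.** For every $n\ge 2$ and every $0<d<1$, a random group on $n$ generators at density $d$, in the model with cyclically reduced relators, satisfies property $\mathrm{(FA)}$ with overwhelming probability; that is, $$\lim_{L\to\infty}\Pr\bigl(\langle S\mid R\rangle \text{ satisfies property } \mathrm{(FA)}\bigr)=1 .$$ -/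

import Mathlib

universe u v

/-- Serre's property (FA): every action of `G` by automorphisms, without inversions, on a
(nonempty) simplicial tree `T` fixes a vertex. -/
def HasPropertyFA (G : Type v) [Group G] : Prop :=
  ∀ (V : Type u) (T : SimpleGraph V), T.IsTree →
    ∀ φ : G →* (T ≃g T),
      (∀ (g : G) (x y : V), T.Adj x y → ¬ (φ g x = y ∧ φ g y = x)) →
        ∃ x : V, ∀ g : G, φ g x = x

namespace RandomGroup

/-- The elements of the free group on `n` generators represented by cyclically reduced words of
length `L`. -/
def cyclicRelators (n L : ℕ) : Set (FreeGroup (Fin n)) :=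
  {r | FreeGroup.IsCyclicallyReduced r.toWord ∧ r.toWord.length = L}

/-- The number `⌊(2n-1)^(dL)⌋` of relators at density `d` and length `L`. -/
noncomputable def numRelators (n : ℕ) (d : ℝ) (L : ℕ) : ℕ :=
  ⌊(2 * (n : ℝ) - 1) ^ (d * (L : ℝ))⌋₊

/-- The sample space at density `d` and length `L`: tuples of `⌊(2n-1)^(dL)⌋` cyclically reduced
relators of length `L` (repetitions are allowed). -/
abbrev RelatorTuple (n : ℕ) (d : ℝ) (L : ℕ) : Type :=
  Fin (numRelators n d L) → cyclicRelators n L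

/-- The group presented by `⟨s₁, …, sₙ ∣ R⟩`. -/
abbrev presentedBy {n : ℕ} {d : ℝ} {L : ℕ} (R : RelatorTuple n d L) : Type :=
  PresentedGroup (Set.range fun i => (R i : FreeGroup (Fin n)))

instance finite_cyclicRelators (n L : ℕ) : Finite (cyclicRelators n L) := by
  have h : Set.Finite {l : List (Fin n × Bool) | l.length = L} := List.finite_length_eq _ L
  have h2 := h.preimage (f := fun r : FreeGroup (Fin n) => r.toWord)
    (FreeGroup.toWord_injective.injOn)
  exact (h2.subset fun r hr => hr.2).to_subtype

theorem nonempty_cyclicRelators {n : ℕ} (hn : 0 < n) (L : ℕ) :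
    Nonempty (cyclicRelators n L) := by
  refine ⟨⟨FreeGroup.of ⟨0, hn⟩ ^ L, ?_, ?_⟩⟩
  · rw [FreeGroup.toWord_of_pow, FreeGroup.isCyclicallyReduced_iff]
    refine ⟨?_, ?_⟩
    · have := FreeGroup.isReduced_toWord (x := FreeGroup.of (⟨0, hn⟩ : Fin n) ^ L)
      rwa [FreeGroup.toWord_of_pow] at this
    · intro a ha b hb _
      rw [List.eq_of_mem_replicate (List.mem_of_mem_getLast? ha),
        List.eq_of_mem_replicate (List.mem_of_mem_head? hb)]
  · rw [FreeGroup.toWord_of_pow, List.length_replicate]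

/-- The probability of an event for the uniform distribution on tuples of relators, that is, for
relators chosen independently and uniformly. The sample space is finite, and nonempty if
`0 < n`. -/
noncomputable def prob {n : ℕ} {d : ℝ} {L : ℕ} (E : Set (RelatorTuple n d L)) : ℝ :=
  (Nat.card E : ℝ) / (Nat.card (RelatorTuple n d L) : ℝ)

/-- An event occurs with overwhelming probability at density `d` if its probability tends to `1`
as the length `L` of the relators tends to infinity. -/
def WithOverwhelmingProbability (n : ℕ) (d : ℝ) (E : ∀ L : ℕ, Set (RelatorTuple n d L)) : Prop :=
  Filter.Tendsto (fun L : ℕ => prob (E L)) Filter.atTop (nhds 1)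

theorem prob_univ {n : ℕ} (hn : 0 < n) (d : ℝ) (L : ℕ) :
    prob (Set.univ : Set (RelatorTuple n d L)) = 1 := by
  have := nonempty_cyclicRelators hn L
  have h : (Nat.card (RelatorTuple n d L) : ℝ) ≠ 0 := by
    exact_mod_cast Nat.card_pos.ne'
  unfold prob
  rw [Nat.card_congr (Equiv.Set.univ _), div_self h]

end RandomGroup

/-! Write q = 2n - 1. Suppose the presented group acts on a tree without a fixed vertex, and pull
the action back to the free group. At a vertex minimising the total displacement by a ball,
comparison with a neighbour (`card_translates_le`) yields an edge with a definite share of its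
translates on each side. Hence many short elements map some half-tree H strictly into itself,
possibly after composing two exchanges of H with its complement (`exists_halfSpace`,
`exists_shrinking_weight`).

The elements shrinking H form a semigroup. Give g the weight a ^ |g|, where 1/q < a ≤ q ^ (-1/2).
Weights are multiplicative up to a polynomial factor (`weight_mul_le`), so a set Q of short
shrinking elements with large weight generates a semigroup with about a ^ (-l) elements of some
length l near L (`exists_length_semigroup`). One suffix p makes at least 1/(2n) of them cyclically
reduced of length L. If p⁻¹ does not shrink H, each product r p acts nontrivially, because r does
shrink H (`exists_productRelators`).

So no such product is a relator. The set of products depends only on Q and p, not on the tree, and a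
union bound over finitely many pairs handles all actions at once. With θ = q ^ (d/8), a = θ²/q and
balls of radius about dL/16, there are exp(O(L θ ^ L)) pairs, each set has density about θ ^ (-3L)
up to a factor linear in L, and there are about θ ^ (8L) relators; the probability of missing a
given set is at most exp(-θ ^ (2L)), which beats the number of pairs. -/

namespace RandomGroup

/-! ### Half-trees and distances in a tree. -/

section Tree

variable {V : Type u} {T : SimpleGraph V}

/-- The vertices of a tree that are closer to `w` than to `v`; for adjacent `v` and `w`, this is
the half-tree on the side of `w` cut out by the edge `vw`. -/
def halfTree (T : SimpleGraph V) (v w : V) : Set V := {x | T.dist x w < T.dist x v}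

theorem dist_iso (f : T ≃g T) (hT : T.Connected) (x y : V) : T.dist (f x) (f y) = T.dist x y := by
  have key : ∀ (f : T ≃g T) (x y : V), T.dist (f x) (f y) ≤ T.dist x y := by
    intro f x y
    obtain ⟨p, hp⟩ := hT.exists_walk_length_eq_dist x y
    rw [← hp, ← SimpleGraph.Walk.length_map f.toHom p]
    exact SimpleGraph.dist_le _
  refine le_antisymm (key f x y) ?_
  simpa using key f.symm (f x) (f y)

theorem compl_halfTree (hT : T.IsTree) {v w : V} (h : T.Adj v w) :
    (halfTree T v w)ᶜ = halfTree T w v := by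
  ext x
  have := hT.dist_ne_of_adj x h
  simp only [halfTree, Set.mem_compl_iff, Set.mem_ofPred_eq]
  omega

theorem dist_of_mem_halfTree (hT : T.IsTree) {v w x : V} (h : T.Adj v w)
    (hx : x ∈ halfTree T v w) : T.dist x v = T.dist x w + 1 := by
  have h1 := hT.connected.dist_triangle (u := x) (v := w) (w := v)
  have h2 : T.dist w v = 1 := SimpleGraph.dist_eq_one_iff_adj.2 h.symm
  have h3 : T.dist x w < T.dist x v := hx
  omega

theorem right_mem_halfTree {v w : V} (h : T.Adj v w) : w ∈ halfTree T v w := by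
  have h2 : T.dist w v = 1 := SimpleGraph.dist_eq_one_iff_adj.2 h.symm
  simp [halfTree, h2]

/-- The only edge of a tree joining two complementary half-trees is the one defining them. -/
theorem eq_of_adj_of_mem_halfTree (hT : T.IsTree) {v w a b : V} (h : T.Adj v w)
    (hab : T.Adj a b) (ha : a ∉ halfTree T v w) (hb : b ∈ halfTree T v w) : a = v ∧ b = w := by
  have ha' : a ∈ halfTree T w v := by rwa [← compl_halfTree hT h]
  have h1 := dist_of_mem_halfTree hT h.symm ha'
  have h2 := dist_of_mem_halfTree hT h hb
  have h3 := hT.connected.dist_triangle (u := a) (v := b) (w := w)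
  have h4 := hT.connected.dist_triangle (u := b) (v := a) (w := v)
  have h5 : T.dist a b = 1 := SimpleGraph.dist_eq_one_iff_adj.2 hab
  have h6 : T.dist b a = 1 := SimpleGraph.dist_eq_one_iff_adj.2 hab.symm
  obtain ⟨p, hp⟩ := hT.connected.exists_walk_length_eq_dist a v
  obtain ⟨r, hr⟩ := hT.connected.exists_walk_length_eq_dist b w
  -- The distances a–v and b–w agree, so a → v → w and a → b → w are both geodesics; they coincide
  -- by uniqueness of paths in a tree.
  have hP1 : (p.concat h).IsPath := by
    apply SimpleGraph.Walk.isPath_of_length_eq_dist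
    rw [SimpleGraph.Walk.length_concat]; omega
  have hP2 : (SimpleGraph.Walk.cons hab r).IsPath := by
    apply SimpleGraph.Walk.isPath_of_length_eq_dist
    rw [SimpleGraph.Walk.length_cons]; omega
  classical
  have heq := (hT.existsUnique_path a w).unique hP1 hP2
  have hbs : b ∈ (p.concat h).support := by rw [heq]; simp
  rw [SimpleGraph.Walk.support_concat] at hbs
  have hbw : b = w := by
    rcases (by simpa using hbs : b ∈ p.support ∨ b = w) with hb' | hb'
    · exfalso
      have e1 := SimpleGraph.dist_le (p.dropUntil b hb')
      have e2 := p.length_dropUntil_le_length hb'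
      omega
    · exact hb'
  refine ⟨?_, hbw⟩
  have : T.dist b w = 0 := by rw [hbw]; simp
  rw [← hT.connected.dist_eq_zero_iff]
  omega

/-- A geodesic from x to y has to leave the complement of the half-tree, and the edge vw is the only
exit. -/
theorem dist_eq_of_mem_halfTree (hT : T.IsTree) {v w x y : V} (h : T.Adj v w)
    (hx : x ∉ halfTree T v w) (hy : y ∈ halfTree T v w) :
    T.dist x y = T.dist x v + 1 + T.dist w y := by
  have hy2 := dist_of_mem_halfTree hT h hy
  obtain ⟨p, hp⟩ := hT.connected.exists_walk_length_eq_dist x y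
  obtain ⟨d, hd, hd1, hd2⟩ := p.exists_boundary_dart (halfTree T v w)ᶜ hx (by simpa using hy)
  have hdv := (eq_of_adj_of_mem_halfTree hT h d.adj hd1 (by simpa using hd2)).1
  have hv : v ∈ p.support := hdv ▸ p.dart_fst_mem_support_of_mem_darts hd
  classical
  have e := congrArg SimpleGraph.Walk.length (p.take_spec hv)
  rw [SimpleGraph.Walk.length_append] at e
  have e1 := SimpleGraph.dist_le (p.takeUntil v hv)
  have e2 := SimpleGraph.dist_le (p.dropUntil v hv)
  have e3 := hT.connected.dist_triangle (u := x) (v := v) (w := y)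
  rw [SimpleGraph.dist_comm (u := w), ← hp]
  rw [SimpleGraph.dist_comm (u := v)] at e2 e3
  omega

/-- The first step of a geodesic. -/
theorem exists_adj_mem_halfTree (hT : T.IsTree) {v x : V} (h : x ≠ v) :
    ∃ w, T.Adj v w ∧ x ∈ halfTree T v w := by
  obtain ⟨p, hp⟩ := hT.connected.exists_walk_length_eq_dist v x
  cases p with
  | nil => exact absurd rfl h
  | @cons _ w _ hvw r =>
    refine ⟨w, hvw, ?_⟩
    have := SimpleGraph.dist_le r
    rw [SimpleGraph.Walk.length_cons, SimpleGraph.dist_comm] at hp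
    rw [SimpleGraph.dist_comm] at this
    simp only [halfTree, Set.mem_ofPred_eq]
    omega

theorem iso_mem_halfTree (hT : T.Connected) (f : T ≃g T) {v w x : V} :
    f x ∈ halfTree T (f v) (f w) ↔ x ∈ halfTree T v w := by
  simp [halfTree, dist_iso f hT]

theorem image_halfTree (hT : T.Connected) (f : T ≃g T) (v w : V) :
    f '' halfTree T v w = halfTree T (f v) (f w) := by
  ext x
  constructor
  · rintro ⟨y, hy, rfl⟩
    exact (iso_mem_halfTree hT f).2 hy
  · intro hx
    refine ⟨f.symm x, (iso_mem_halfTree hT f).1 (by simpa using hx), by simp⟩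

/-- Half-trees bounded by an edge contained in a half-tree are nested. -/
theorem halfTree_nested (hT : T.IsTree) {v w a b : V} (h : T.Adj v w) (hab : T.Adj a b)
    (ha : a ∈ halfTree T v w) (hinv : ¬ (a = w ∧ b = v)) :
    halfTree T a b ⊂ halfTree T v w ∨ (halfTree T a b)ᶜ ⊂ halfTree T v w := by
  have hb : b ∈ halfTree T v w := by
    by_contra hb
    exact hinv ((eq_of_adj_of_mem_halfTree hT h hab.symm hb ha).symm)
  -- Seen from a point outside the half-tree, a and b are reached through w, so that point lies on
  -- the same side of ab as w.
  have key : ∀ {a b : V}, T.Adj a b → a ∈ halfTree T v w → b ∈ halfTree T v w →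
      w ∉ halfTree T a b → halfTree T a b ⊂ halfTree T v w := by
    intro a b hab ha hb hw
    refine ⟨fun x hx => ?_, fun hh => hw (hh (right_mem_halfTree h))⟩
    by_contra hxH
    have e1 := dist_eq_of_mem_halfTree hT h hxH ha
    have e2 := dist_eq_of_mem_halfTree hT h hxH hb
    apply hw
    simp only [halfTree, Set.mem_ofPred_eq] at hx ⊢
    omega
  by_cases hw : w ∈ halfTree T a b
  · right
    rw [compl_halfTree hT hab]
    refine key hab.symm hb ha ?_
    rw [← compl_halfTree hT hab]
    simpa using hw
  · exact .inl (key hab ha hb hw)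

/-- If `y` is not beyond the first edge from `v` to `g v`, then `g⁻¹ y` is beyond the first edge
from `v` to `g⁻¹ v`. -/
theorem symm_mem_halfTree (hT : T.IsTree) (f : T ≃g T) {v w w' y : V} (h : T.Adj v w)
    (h' : T.Adj v w') (hf : f v ∈ halfTree T v w) (hf' : f.symm v ∈ halfTree T v w')
    (hy : y ∉ halfTree T v w) : f.symm y ∈ halfTree T v w' := by
  -- The geodesic from y to f v passes through v. Applying f⁻¹, the one from f⁻¹ y to v passes
  -- through f⁻¹ v, hence ends with the edge w'v.
  have e1 := dist_eq_of_mem_halfTree hT h hy hf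
  have e2 := dist_of_mem_halfTree hT h hf
  have e3 := dist_of_mem_halfTree hT h' hf'
  have e4 : T.dist (f.symm y) v = T.dist y (f v) := by
    rw [← dist_iso f hT.connected]; simp
  have e5 : T.dist (f.symm v) v = T.dist v (f v) := by
    rw [← dist_iso f hT.connected]; simp
  have e6 := hT.connected.dist_triangle (u := f.symm y) (v := f.symm v) (w := w')
  have e7 := dist_iso f.symm hT.connected y v
  rw [SimpleGraph.dist_comm (u := f v)] at e2
  rw [SimpleGraph.dist_comm (u := w)] at e1
  have e8 := SimpleGraph.dist_comm (G := T) (u := f v) (v := w)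
  have e9 : T.dist v (f v) = T.dist (f v) w + 1 := by omega
  simp only [halfTree, Set.mem_ofPred_eq]
  omega

end Tree

/-! ### Displacement and balanced edges. -/

section Action

variable {V : Type u} {T : SimpleGraph V} {n : ℕ}

theorem finite_norm_le (n N : ℕ) : {g : FreeGroup (Fin n) | g.norm ≤ N}.Finite := by
  have h := (List.finite_length_le (Fin n × Bool) N).preimage
    (f := fun r : FreeGroup (Fin n) => r.toWord) FreeGroup.toWord_injective.injOn
  exact h.subset fun r hr => hr

/-- The ball of radius `N` in the free group on `n` generators. -/
noncomputable def ball (n N : ℕ) : Finset (FreeGroup (Fin n)) := (finite_norm_le n N).toFinset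

@[simp] theorem mem_ball {N : ℕ} {g : FreeGroup (Fin n)} : g ∈ ball n N ↔ g.norm ≤ N := by
  simp [ball]

open scoped Classical in
/-- At a vertex minimising the total displacement by a ball, at most as many translates lie beyond
an adjacent edge as translates of that edge lie on the near side. -/
theorem card_translates_le (hT : T.IsTree) (φ : FreeGroup (Fin n) →* (T ≃g T)) (B : ℕ) {v w : V}
    (h : T.Adj v w)
    (hmin : ∑ g ∈ ball n B, T.dist v (φ g v) ≤ ∑ g ∈ ball n B, T.dist w (φ g w)) :
    ((ball n B).filter fun g => φ g v ∈ halfTree T v w).card ≤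
      ((ball n B).filter fun g => φ g w ∉ halfTree T v w).card := by
  have hsign : ∀ x : V, (T.dist x w : ℤ) - T.dist x v =
      1 - 2 * (if x ∈ halfTree T v w then 1 else 0) := by
    intro x
    split_ifs with hx
    · have := dist_of_mem_halfTree hT h hx
      push_cast [this]; ring
    · have := dist_of_mem_halfTree hT h.symm (x := x) (by rwa [← compl_halfTree hT h])
      push_cast [this]; ring
  have hinv : ∀ (g : FreeGroup (Fin n)) (x y : V), T.dist x (φ g y) = T.dist (φ g⁻¹ x) y := by
    intro g x y
    rw [← dist_iso (φ g⁻¹) hT.connected x, ← RelIso.mul_apply, ← map_mul]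
    simp
  have hsymm : ∀ f : FreeGroup (Fin n) → ℤ, ∑ g ∈ ball n B, f g⁻¹ = ∑ g ∈ ball n B, f g := by
    intro f
    refine Finset.sum_nbij' (fun g => g⁻¹) (fun g => g⁻¹) ?_ ?_ ?_ ?_ ?_ <;> simp
  -- Move the two endpoints from v to w one at a time, each move changing the distance by ±1. The
  -- second move is read off after applying g⁻¹, which is harmless since the ball is closed under
  -- inversion.
  have hterm : ∀ g : FreeGroup (Fin n), (T.dist w (φ g w) : ℤ) - T.dist v (φ g v) =
      (1 - 2 * (if φ g w ∈ halfTree T v w then 1 else 0)) +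
        (1 - 2 * (if φ g⁻¹ v ∈ halfTree T v w then 1 else 0)) := by
    intro g
    rw [← hsign, ← hsign, ← hinv g v w, ← hinv g v v, SimpleGraph.dist_comm (v := w),
      SimpleGraph.dist_comm (u := φ g w) (v := v)]
    ring
  have hsum : (0 : ℤ) ≤ ∑ g ∈ ball n B, ((T.dist w (φ g w) : ℤ) - T.dist v (φ g v)) := by
    rw [Finset.sum_sub_distrib]
    have : ((∑ g ∈ ball n B, T.dist v (φ g v) : ℕ) : ℤ) ≤
      (∑ g ∈ ball n B, T.dist w (φ g w) : ℕ) := by exact_mod_cast hmin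
    push_cast at this
    linarith
  rw [Finset.sum_congr rfl fun g _ => hterm g, Finset.sum_add_distrib,
    hsymm (fun g => 1 - 2 * (if φ g v ∈ halfTree T v w then 1 else 0)),
    Finset.sum_sub_distrib, Finset.sum_sub_distrib, ← Finset.mul_sum, ← Finset.mul_sum,
    Finset.sum_boole, Finset.sum_boole] at hsum
  have hpart := Finset.card_filter_add_card_filter_not (s := ball n B)
    (fun g => φ g w ∈ halfTree T v w)
  simp only [Finset.sum_const, nsmul_eq_mul, mul_one] at hsum
  have hpart' : (((ball n B).filter fun g => φ g w ∈ halfTree T v w).card : ℤ) +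
    ((ball n B).filter fun g => φ g w ∉ halfTree T v w).card = (ball n B).card := by
    exact_mod_cast hpart
  zify
  linarith

theorem exists_generator_moving (φ : FreeGroup (Fin n) →* (T ≃g T))
    (hfix : ∀ x, ∃ g, φ g x ≠ x) (x : V) : ∃ i, φ (FreeGroup.of i) x ≠ x := by
  by_contra! hcon
  obtain ⟨g, hg⟩ := hfix x
  refine hg ?_
  clear hg
  induction g using FreeGroup.induction_on with
  | C1 => simp
  | of i => exact hcon i
  | inv_of i h =>
    rw [map_inv]
    conv_lhs => rw [← hcon i]
    rw [← RelIso.mul_apply]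
    simp
  | mul a b ha hb =>
    rw [map_mul, RelIso.mul_apply, hb, ha]

open scoped Classical in
/-- Some edge has a definite proportion of its translates by a ball on each side. -/
theorem exists_balanced_edge (hT : T.IsTree) (φ : FreeGroup (Fin n) →* (T ≃g T))
    (hfix : ∀ x, ∃ g, φ g x ≠ x) (B : ℕ) : ∃ v w, T.Adj v w ∧
      (ball n B).card ≤ 2 * ((ball n (B + 1)).filter fun g => φ g v ∈ halfTree T v w).card ∧
      (ball n B).card ≤ 2 * ((ball n (B + 1)).filter fun g => φ g w ∉ halfTree T v w).card := by
  have := hT.connected.nonempty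
  obtain ⟨v, hv⟩ : ∃ v, ∀ w, ∑ g ∈ ball n (B + 1), T.dist v (φ g v) ≤
      ∑ g ∈ ball n (B + 1), T.dist w (φ g w) := by
    let f : V → ℕ := fun v => ∑ g ∈ ball n (B + 1), T.dist v (φ g v)
    exact ⟨Function.argmin f, fun w => Function.argmin_le f w⟩
  suffices ∃ w, T.Adj v w ∧ (ball n B).card ≤
      2 * ((ball n (B + 1)).filter fun g => φ g v ∈ halfTree T v w).card by
    obtain ⟨w, hvw, hw⟩ := this
    exact ⟨v, w, hvw, hw,
      hw.trans (Nat.mul_le_mul_left 2 (card_translates_le hT φ (B + 1) hvw (hv w)))⟩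
  obtain ⟨i, hi⟩ := exists_generator_moving φ hfix v
  set s : FreeGroup (Fin n) := FreeGroup.of i
  have hi' : (φ s).symm v ≠ v := fun h => hi (by conv_lhs => rw [← h]
                                                 simp)
  obtain ⟨w, hvw, hw⟩ := exists_adj_mem_halfTree hT hi
  obtain ⟨w', hvw', hw'⟩ := exists_adj_mem_halfTree hT hi'
  -- Ping-pong: if too few translates lie beyond w', at least half of the smaller ball misses w',
  -- and left multiplication by s carries those translates beyond w. This costs one unit of radius.
  by_cases hcase : (ball n B).card ≤
      2 * ((ball n (B + 1)).filter fun g => φ g v ∈ halfTree T v w').card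
  · exact ⟨w', hvw', hcase⟩
  refine ⟨w, hvw, ?_⟩
  have h1 : ((ball n B).filter fun g => φ g v ∈ halfTree T v w').card ≤
      ((ball n (B + 1)).filter fun g => φ g v ∈ halfTree T v w').card := by
    apply Finset.card_le_card
    intro g
    simp only [Finset.mem_filter, mem_ball]
    exact fun h => ⟨h.1.trans (Nat.le_succ B), h.2⟩
  have h2 : ((ball n B).filter fun g => φ g v ∉ halfTree T v w').card ≤
      ((ball n (B + 1)).filter fun g => φ g v ∈ halfTree T v w).card := by
    apply Finset.card_le_card_of_injOn (fun g => s * g) _ (mul_right_injective s).injOn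
    intro g hg
    simp only [Finset.coe_filter, mem_ball, Set.mem_ofPred_eq] at hg ⊢
    refine ⟨?_, ?_⟩
    · have := FreeGroup.norm_mul_le s g
      have : s.norm = 1 := FreeGroup.norm_of i
      omega
    · by_contra hcon
      apply hg.2
      have := symm_mem_halfTree hT (φ s) hvw hvw' hw hw' hcon
      rwa [map_mul, RelIso.mul_apply, RelIso.symm_apply_apply] at this
  have h3 := Finset.card_filter_add_card_filter_not (s := ball n B)
    (fun g => φ g v ∈ halfTree T v w')
  omega

end Action

/-! ### Elements that shrink or exchange half-spaces. -/

section HalfSpaces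

variable {V : Type u} {T : SimpleGraph V} {G : Type v} [Group G]

/-- The elements mapping `H` strictly into `K`. -/
def mapsStrictly (φ : G →* (T ≃g T)) (H K : Set V) : Set G := {g | φ g '' H ⊂ K}

theorem image_mul (φ : G →* (T ≃g T)) (g h : G) (H : Set V) :
    φ (g * h) '' H = φ g '' (φ h '' H) := by
  rw [map_mul, Set.image_image]; rfl

theorem mul_mem_mapsStrictly {φ : G →* (T ≃g T)} {H K M : Set V} {g h : G}
    (hg : g ∈ mapsStrictly φ K M) (hh : h ∈ mapsStrictly φ H K) :
    g * h ∈ mapsStrictly φ H M := by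
  change φ (g * h) '' H ⊂ M
  rw [image_mul]
  exact (Set.image_mono hh.subset).trans_ssubset hg

theorem inv_mem_mapsStrictly_iff (φ : G →* (T ≃g T)) (g : G) (H K : Set V) :
    g⁻¹ ∈ mapsStrictly φ H K ↔ H ⊂ φ g '' K := by
  have key : ∀ (f : T ≃g T) (A B : Set V), A ⊂ B → f '' A ⊂ f '' B := fun f A B h =>
    ⟨Set.image_mono h.subset, fun h' => h.2 ((Set.image_subset_image_iff f.injective).1 h')⟩
  constructor
  · intro h
    have := key (φ g) _ _ h
    rwa [← image_mul, mul_inv_cancel, map_one, RelIso.coe_one, Set.image_id] at this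
  · intro h
    have := key (φ g⁻¹) _ _ h
    rwa [← image_mul, inv_mul_cancel, map_one, RelIso.coe_one, Set.image_id] at this

/-- Otherwise H ⊂ g H ⊂ H. This is where strict inclusion pays off: of a cap and its inverse, at
least one does not shrink H. -/
theorem notMem_mapsStrictly_of_inv_mem {φ : G →* (T ≃g T)} {g : G} {H : Set V}
    (h : g⁻¹ ∈ mapsStrictly φ H H) : g ∉ mapsStrictly φ H H := fun h' =>
  (((inv_mem_mapsStrictly_iff φ g H H).1 h).trans h').ne rfl

/-- Nestedness of half-trees, applied to the edge and its translate; the absence of inversions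
excludes the flipped edge, where the inclusion would not be strict. -/
theorem translate_left_mem (hT : T.IsTree) (φ : G →* (T ≃g T))
    (hinv : ∀ (g : G) (x y : V), T.Adj x y → ¬ (φ g x = y ∧ φ g y = x)) {v w : V}
    (h : T.Adj v w) {g : G} (hg : φ g v ∈ halfTree T v w) :
    g ∈ mapsStrictly φ (halfTree T v w) (halfTree T v w) ∨
      g ∈ mapsStrictly φ (halfTree T v w)ᶜ (halfTree T v w) := by
  have := halfTree_nested hT h ((φ g).map_adj_iff.2 h) hg (hinv g v w h)
  rwa [← image_halfTree hT.connected, ← Set.image_compl_eq (φ g).bijective] at this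

theorem translate_right_notMem (hT : T.IsTree) (φ : G →* (T ≃g T))
    (hinv : ∀ (g : G) (x y : V), T.Adj x y → ¬ (φ g x = y ∧ φ g y = x)) {v w : V}
    (h : T.Adj v w) {g : G} (hg : φ g w ∉ halfTree T v w) :
    g⁻¹ ∈ mapsStrictly φ (halfTree T v w) (halfTree T v w) ∨
      g ∈ mapsStrictly φ (halfTree T v w) (halfTree T v w)ᶜ := by
  have hg' : φ g w ∈ halfTree T w v := by rwa [← compl_halfTree hT h]
  rw [inv_mem_mapsStrictly_iff]
  refine (translate_left_mem hT φ hinv h.symm hg').imp (fun h1 => ?_) (fun h1 => ?_)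
  · change φ g '' _ ⊂ _ at h1
    rw [← compl_halfTree hT h, Set.image_compl_eq (φ g).bijective] at h1
    exact compl_lt_compl_iff_lt.1 h1
  · rwa [← compl_halfTree hT h, compl_compl] at h1

open scoped Classical in
/-- For an action without a fixed vertex, some half-space `H` is strictly shrunk by a definite
proportion of a ball, or else both exchanges between `H` and its complement are achieved by such a
proportion. -/
theorem exists_halfSpace {n : ℕ} (hT : T.IsTree) (φ : FreeGroup (Fin n) →* (T ≃g T))
    (hinv : ∀ g x y, T.Adj x y → ¬ (φ g x = y ∧ φ g y = x)) (hfix : ∀ x, ∃ g, φ g x ≠ x)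
    (B : ℕ) : ∃ H : Set V,
      (ball n B).card ≤ 4 * ((ball n (B + 1)).filter (· ∈ mapsStrictly φ H H)).card ∨
      (ball n B).card ≤ 4 * ((ball n (B + 1)).filter (· ∈ mapsStrictly φ Hᶜ H)).card ∧
      (ball n B).card ≤ 4 * ((ball n (B + 1)).filter (· ∈ mapsStrictly φ H Hᶜ)).card := by
  obtain ⟨v, w, h, h1, h2⟩ := exists_balanced_edge hT φ hfix B
  refine ⟨halfTree T v w, ?_⟩
  set H := halfTree T v w
  have e1 : ((ball n (B + 1)).filter fun g => φ g v ∈ H).card ≤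
      ((ball n (B + 1)).filter (· ∈ mapsStrictly φ H H)).card +
      ((ball n (B + 1)).filter (· ∈ mapsStrictly φ Hᶜ H)).card := by
    refine le_trans (Finset.card_le_card ?_) (Finset.card_union_le _ _)
    intro g
    simp only [Finset.mem_union, Finset.mem_filter, ← and_or_left]
    exact And.imp_right (translate_left_mem hT φ hinv h)
  have e2 : ((ball n (B + 1)).filter fun g => φ g w ∉ H).card ≤
      ((ball n (B + 1)).filter (·⁻¹ ∈ mapsStrictly φ H H)).card +
      ((ball n (B + 1)).filter (· ∈ mapsStrictly φ H Hᶜ)).card := by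
    refine le_trans (Finset.card_le_card ?_) (Finset.card_union_le _ _)
    intro g
    simp only [Finset.mem_union, Finset.mem_filter, ← and_or_left]
    exact And.imp_right (translate_right_notMem hT φ hinv h)
  -- Shrinking elements thus enter both counts equally: if they fill less than a quarter, each kind
  -- of exchange must fill a quarter.
  have e3 : ((ball n (B + 1)).filter (·⁻¹ ∈ mapsStrictly φ H H)).card =
      ((ball n (B + 1)).filter (· ∈ mapsStrictly φ H H)).card := by
    refine Finset.card_nbij' (·⁻¹) (·⁻¹) ?_ ?_ ?_ ?_ <;> simp [Set.MapsTo, Set.LeftInvOn]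
  omega

end HalfSpaces

/-! ### Common prefixes and branching in the Cayley tree. -/

section Words

open FreeGroup

theorem isReduced_invRev {α : Type*} [DecidableEq α] {l : List (α × Bool)} (h : IsReduced l) :
    IsReduced (invRev l) := by
  rw [isReduced_iff_reduce_eq, reduce_invRev, h.reduce_eq]

/-- Two reduced words split off a common prefix such that the remainders do not cancel. -/
theorem exists_common_prefix {α : Type*} [DecidableEq α] {l₁ l₂ : List (α × Bool)}
    (h₁ : IsReduced l₁) (h₂ : IsReduced l₂) : ∃ p r₁ r₂, l₁ = p ++ r₁ ∧ l₂ = p ++ r₂ ∧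
      IsReduced r₁ ∧ IsReduced (invRev r₁ ++ r₂) := by
  induction l₁ generalizing l₂ with
  | nil => exact ⟨[], [], l₂, rfl, rfl, .nil, by simpa using h₂⟩
  | cons a l ih =>
    cases l₂ with
    | nil => exact ⟨[], a :: l, [], rfl, rfl, h₁, by simpa using isReduced_invRev h₁⟩
    | cons b r =>
      by_cases hab : a = b
      · subst hab
        obtain ⟨p, r₁, r₂, e₁, e₂, e₃, e₄⟩ :=
          ih (h₁.infix (List.suffix_cons a l).isInfix) (h₂.infix (List.suffix_cons a r).isInfix)
        exact ⟨a :: p, r₁, r₂, by simp [e₁], by simp [e₂], e₃, e₄⟩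
      · refine ⟨[], a :: l, b :: r, rfl, rfl, h₁, ?_⟩
        rw [invRev_cons]
        refine IsReduced.append_overlap ?_ ?_ (by simp [invRev])
        · rw [← invRev_cons]
          exact isReduced_invRev h₁
        · simp only [invRev, List.map_cons, List.map_nil, List.reverse_singleton,
            List.singleton_append, isReduced_cons_cons]
          refine ⟨fun h => ?_, h₂⟩
          rcases a with ⟨a, _ | _⟩ <;> rcases b with ⟨b, _ | _⟩ <;> simp_all

theorem toWord_mk_of_isReduced {α : Type*} [DecidableEq α] {l : List (α × Bool)}
    (h : IsReduced l) : (mk l).toWord = l := by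
  rw [toWord_mk, h.reduce_eq]

/-- Every element `x` hangs off the geodesic from `1` to `g` at a prefix of `g`. -/
theorem exists_prefix_norm {α : Type*} [DecidableEq α] (x g : FreeGroup α) :
    ∃ i ≤ g.norm, ((mk (g.toWord.take i))⁻¹ * x).norm ≤ x.norm ∧
      x.norm + (x⁻¹ * g).norm = g.norm + 2 * ((mk (g.toWord.take i))⁻¹ * x).norm := by
  obtain ⟨p, r₁, r₂, e₁, e₂, e₃, e₄⟩ :=
    exists_common_prefix (isReduced_toWord (x := x)) (isReduced_toWord (x := g))
  have hx : x = mk p * mk r₁ := by rw [mul_mk, ← e₁, mk_toWord]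
  have hg : g = mk p * mk r₂ := by rw [mul_mk, ← e₂, mk_toWord]
  have hp : mk (g.toWord.take p.length) = mk p := by rw [e₂]; simp
  have n₁ : x.norm = p.length + r₁.length := by rw [FreeGroup.norm, e₁, List.length_append]
  have n₂ : g.norm = p.length + r₂.length := by rw [FreeGroup.norm, e₂, List.length_append]
  have h1 : (mk p)⁻¹ * x = mk r₁ := by rw [hx]; group
  have h2 : x⁻¹ * g = mk (invRev r₁ ++ r₂) := by
    rw [← mul_mk, ← inv_mk, hx, hg]; group
  have n₃ : (mk r₁).norm = r₁.length := by rw [FreeGroup.norm, toWord_mk_of_isReduced e₃]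
  have n₄ : (x⁻¹ * g).norm = r₁.length + r₂.length := by
    rw [h2, FreeGroup.norm, toWord_mk_of_isReduced e₄, List.length_append, invRev_length]
  refine ⟨p.length, by omega, ?_⟩
  rw [hp, h1, n₃]
  omega

end Words

/-! ### Sizes of spheres and balls in the free group. -/

section Counting

open FreeGroup

variable {n : ℕ}

theorem finite_reducedWords (n m : ℕ) :
    {l : List (Fin n × Bool) | IsReduced l ∧ l.length = m}.Finite :=
  (List.finite_length_eq (Fin n × Bool) m).subset fun _ h => h.2

/-- The reduced words of length `m`. -/
noncomputable def reducedWords (n m : ℕ) : Finset (List (Fin n × Bool)) :=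
  (finite_reducedWords n m).toFinset

@[simp] theorem mem_reducedWords {m : ℕ} {l : List (Fin n × Bool)} :
    l ∈ reducedWords n m ↔ IsReduced l ∧ l.length = m := by
  simp [reducedWords]

theorem card_compatible (b : Fin n × Bool) :
    (Finset.univ.filter fun a : Fin n × Bool => a.1 = b.1 → a.2 = b.2).card = 2 * n - 1 := by
  have : (Finset.univ.filter fun a : Fin n × Bool => a.1 = b.1 → a.2 = b.2) =
      Finset.univ.erase (b.1, !b.2) := by
    ext ⟨i, c⟩
    rcases b with ⟨j, d⟩
    cases c <;> cases d <;> simp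
  rw [this, Finset.card_erase_of_mem (Finset.mem_univ _), Finset.card_univ]
  simp [mul_comm]

theorem card_reducedWords_succ (n m : ℕ) :
    (reducedWords n (m + 1)).card = 2 * n * (2 * n - 1) ^ m := by
  induction m with
  | zero =>
    have : reducedWords n 1 = Finset.univ.image fun a : Fin n × Bool => [a] := by
      ext l
      simp only [mem_reducedWords, List.length_eq_one_iff, Finset.mem_image, Finset.mem_univ,
        true_and]
      constructor
      · rintro ⟨-, a, rfl⟩; exact ⟨a, rfl⟩
      · rintro ⟨a, rfl⟩; exact ⟨.singleton, a, rfl⟩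
    rw [zero_add, this, Finset.card_image_of_injective _ fun a b h => by simpa using h]
    simp [mul_comm]
  | succ m ih =>
    have hmaps : ∀ l ∈ reducedWords n (m + 2), l.tail ∈ reducedWords n (m + 1) := by
      intro l hl
      rw [mem_reducedWords] at hl ⊢
      exact ⟨hl.1.infix (List.tail_suffix l).isInfix, by simp [hl.2]⟩
    rw [Finset.card_eq_sum_card_fiberwise hmaps, Finset.sum_const_nat (m := 2 * n - 1), ih, pow_succ]
    · ring
    intro l hl
    rw [mem_reducedWords] at hl
    obtain ⟨b, r, rfl⟩ := List.exists_cons_of_length_eq_add_one hl.2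
    rw [← card_compatible b]
    symm
    refine Finset.card_nbij (fun a => a :: b :: r) ?_ ?_ ?_
    · intro a ha
      simp only [Finset.mem_coe, Finset.mem_filter, Finset.mem_univ, true_and, mem_reducedWords,
        isReduced_cons_cons, List.tail_cons, and_true] at ha ⊢
      exact ⟨⟨ha, hl.1⟩, by simpa using hl.2⟩
    · intro a _ a' _ h
      simpa using h
    · intro l' hl'
      simp only [Finset.coe_filter, mem_reducedWords, Set.mem_ofPred_eq] at hl'
      obtain ⟨a, r', rfl⟩ := List.exists_cons_of_length_eq_add_one hl'.1.2
      obtain ⟨⟨h1, h2⟩, rfl⟩ := hl'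
      rw [isReduced_cons_cons] at h1
      exact ⟨a, by simpa using h1.1, by simp⟩

theorem card_reducedWords_le (hn : 2 ≤ n) (m : ℕ) :
    (reducedWords n m).card ≤ 2 * (2 * n - 1) ^ m := by
  cases m with
  | zero =>
    have : reducedWords n 0 ⊆ {[]} := by
      intro l; simp only [mem_reducedWords, Finset.mem_singleton, List.length_eq_zero_iff]
      exact fun h => h.2
    exact (Finset.card_le_card this).trans (by simp)
  | succ m =>
    rw [card_reducedWords_succ, pow_succ']
    rw [← mul_assoc]
    exact Nat.mul_le_mul_right _ (by omega)

theorem le_card_reducedWords (n m : ℕ) : (2 * n - 1) ^ m ≤ (reducedWords n m).card := by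
  cases m with
  | zero =>
    simp only [pow_zero]
    exact Finset.card_pos.2 ⟨[], by simp⟩
  | succ m =>
    rw [card_reducedWords_succ, pow_succ']
    exact Nat.mul_le_mul_right _ (by omega)

theorem card_sphere (n m N : ℕ) (h : m ≤ N) :
    ((ball n N).filter fun g => g.norm = m).card = (reducedWords n m).card := by
  refine Finset.card_nbij' toWord mk ?_ ?_ ?_ ?_
  · intro g hg
    simp only [Finset.coe_filter, mem_ball, Set.mem_ofPred_eq] at hg
    simp only [Finset.mem_coe, mem_reducedWords]
    exact ⟨isReduced_toWord, hg.2⟩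
  · intro l hl
    simp only [Finset.mem_coe, mem_reducedWords] at hl
    have h1 : (mk l).norm = m := by rw [FreeGroup.norm, toWord_mk_of_isReduced hl.1, hl.2]
    exact Finset.mem_coe.2 (Finset.mem_filter.2 ⟨mem_ball.2 (h1.le.trans h), h1⟩)
  · intro g _
    exact mk_toWord
  · intro l hl
    simp only [Finset.mem_coe, mem_reducedWords] at hl
    exact toWord_mk_of_isReduced hl.1

theorem le_card_ball (n B : ℕ) : (2 * n - 1) ^ B ≤ (ball n B).card :=
  (le_card_reducedWords n B).trans
    ((card_sphere n B B le_rfl).symm.le.trans (Finset.card_filter_le _ _))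

/-- Sums over a ball of a radial function. -/
theorem sum_ball_radial (n N : ℕ) (f : ℕ → ℝ) :
    ∑ g ∈ ball n N, f g.norm = ∑ m ∈ Finset.range (N + 1), (reducedWords n m).card * f m := by
  rw [← Finset.sum_fiberwise_of_maps_to (s := ball n N) (t := Finset.range (N + 1))
    (g := fun g => g.norm) (fun g hg => by simpa [Nat.lt_succ_iff] using hg)]
  refine Finset.sum_congr rfl fun m hm => ?_
  rw [Finset.sum_congr rfl (g := fun _ => f m), Finset.sum_const, nsmul_eq_mul,
    card_sphere n m N (by simpa [Nat.lt_succ_iff] using hm)]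
  intro g hg
  rw [(Finset.mem_filter.1 hg).2]

theorem card_ball_le (hn : 2 ≤ n) (N : ℕ) : (ball n N).card ≤ 2 * (N + 1) * (2 * n - 1) ^ N := by
  have h : (ball n N).card = ∑ m ∈ Finset.range (N + 1), (reducedWords n m).card := by
    have := sum_ball_radial n N (fun _ => 1)
    simp only [Finset.sum_const, nsmul_eq_mul, mul_one] at this
    exact_mod_cast this
  rw [h]
  refine (Finset.sum_le_card_nsmul _ _ (2 * (2 * n - 1) ^ N) fun m hm => ?_).trans ?_
  · refine (card_reducedWords_le hn m).trans (Nat.mul_le_mul_left 2 ?_)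
    exact Nat.pow_le_pow_right (by omega) (by simpa [Nat.lt_succ_iff] using hm)
  · rw [Finset.card_range, smul_eq_mul]
    exact le_of_eq (by ring)

end Counting

/-! ### Near-multiplicativity of weights. -/

section Weight

open FreeGroup

variable {n : ℕ} {a : ℝ}

/-- The total weight of a finite set, an element of length `m` having weight `a ^ m`. -/
noncomputable def weight (a : ℝ) (X : Finset (FreeGroup (Fin n))) : ℝ := ∑ g ∈ X, a ^ g.norm

theorem weight_mono (ha : 0 ≤ a) {X Y : Finset (FreeGroup (Fin n))} (h : X ⊆ Y) :
    weight a X ≤ weight a Y :=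
  Finset.sum_le_sum_of_subset_of_nonneg h fun _ _ _ => pow_nonneg ha _

/-- The sphere of radius m has at most 2 q ^ m elements, so it contributes at most 2 (q a²) ^ m ≤ 2.
-/
theorem weight_sq_ball_le (hn : 2 ≤ n) (haq : ((2 * n - 1 : ℕ) : ℝ) * a ^ 2 ≤ 1)
    (N : ℕ) : weight (a ^ 2) (ball n N) ≤ 2 * (N + 1) := by
  rw [weight, sum_ball_radial]
  refine (Finset.sum_le_card_nsmul _ _ 2 fun m _ => ?_).trans ?_
  · have h1 : ((reducedWords n m).card : ℝ) ≤ 2 * ((2 * n - 1 : ℕ) : ℝ) ^ m := by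
      exact_mod_cast card_reducedWords_le hn m
    calc ((reducedWords n m).card : ℝ) * (a ^ 2) ^ m
        ≤ 2 * ((2 * n - 1 : ℕ) : ℝ) ^ m * (a ^ 2) ^ m := by gcongr
      _ = 2 * (((2 * n - 1 : ℕ) : ℝ) * a ^ 2) ^ m := by rw [mul_pow]; ring
      _ ≤ 2 * 1 := by gcongr; exact pow_le_one₀ (by positivity) haq
      _ = 2 := by norm_num
  · rw [Finset.card_range, nsmul_eq_mul]
    push_cast
    linarith

/-- Factorisations of a given element have bounded total weight. -/
theorem sum_factorizations_le (ha : 0 ≤ a) {N : ℕ} {g : FreeGroup (Fin n)} (hg : g.norm ≤ N) :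
    ∑ x ∈ ball n N, a ^ (x.norm + (x⁻¹ * g).norm) ≤
      (N + 1) * weight (a ^ 2) (ball n N) * a ^ g.norm := by
  choose i hi h1 h2 using fun x : FreeGroup (Fin n) => exists_prefix_norm x g
  -- x is encoded by its branch point on the geodesic from 1 to g and the branch u leading to it;
  -- the detour along u costs a factor a ^ (2 |u|).
  let ι : FreeGroup (Fin n) → ℕ × FreeGroup (Fin n) := fun x =>
    (i x, (mk (g.toWord.take (i x)))⁻¹ * x)
  have hι : Function.Injective ι := by
    intro x y hxy
    simp only [ι, Prod.mk.injEq] at hxy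
    obtain ⟨e1, e2⟩ := hxy
    rw [e1] at e2
    exact mul_left_cancel e2
  let F : ℕ × FreeGroup (Fin n) → ℝ := fun y => (a ^ 2) ^ y.2.norm * a ^ g.norm
  calc ∑ x ∈ ball n N, a ^ (x.norm + (x⁻¹ * g).norm) = ∑ x ∈ ball n N, F (ι x) := by
        refine Finset.sum_congr rfl fun x _ => ?_
        simp only [F, ι]
        rw [h2 x, ← pow_mul, pow_add, mul_comm]
    _ = ∑ y ∈ (ball n N).image ι, F y := (Finset.sum_image hι.injOn).symm
    _ ≤ ∑ y ∈ Finset.range (N + 1) ×ˢ ball n N, F y := by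
        refine Finset.sum_le_sum_of_subset_of_nonneg ?_ fun _ _ _ => by positivity
        intro y hy
        obtain ⟨x, hx, rfl⟩ := Finset.mem_image.1 hy
        rw [mem_ball] at hx
        simp only [ι, Finset.mem_product, Finset.mem_range, mem_ball]
        exact ⟨Nat.lt_succ_of_le ((hi x).trans hg), (h1 x).trans hx⟩
    _ = (N + 1) * weight (a ^ 2) (ball n N) * a ^ g.norm := by
        rw [Finset.sum_product]
        simp only [F, Finset.sum_const, Finset.card_range, nsmul_eq_mul, ← Finset.sum_mul, weight]
        push_cast
        ring

-- Group the pairs by their product: the bound on factorisations limits the loss from coinciding or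
-- cancelling products to a polynomial factor.
open scoped Pointwise in
theorem weight_mul_le (hn : 2 ≤ n) (ha : 0 ≤ a) (haq : ((2 * n - 1 : ℕ) : ℝ) * a ^ 2 ≤ 1)
    {N : ℕ} {X Y : Finset (FreeGroup (Fin n))} (hX : X ⊆ ball n N) (hXY : X * Y ⊆ ball n N) :
    weight a X * weight a Y ≤ 2 * (N + 1) ^ 2 * weight a (X * Y) := by
  have h1 : weight a X * weight a Y = ∑ g ∈ X * Y,
      ∑ z ∈ (X ×ˢ Y).filter (fun z => z.1 * z.2 = g), a ^ (z.1.norm + z.2.norm) := by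
    rw [Finset.sum_fiberwise_of_maps_to (fun z hz => Finset.mul_mem_mul (Finset.mem_product.1 hz).1
      (Finset.mem_product.1 hz).2), weight, weight, Finset.sum_mul_sum, ← Finset.sum_product']
    simp [pow_add]
  rw [h1, weight, Finset.mul_sum]
  refine Finset.sum_le_sum fun g hg => ?_
  have hg' : g.norm ≤ N := mem_ball.1 (hXY hg)
  calc ∑ z ∈ (X ×ˢ Y).filter (fun z => z.1 * z.2 = g), a ^ (z.1.norm + z.2.norm)
      = ∑ z ∈ (X ×ˢ Y).filter (fun z => z.1 * z.2 = g), a ^ (z.1.norm + (z.1⁻¹ * g).norm) := by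
        refine Finset.sum_congr rfl fun z hz => ?_
        rw [← (Finset.mem_filter.1 hz).2, inv_mul_cancel_left]
    _ = ∑ x ∈ ((X ×ˢ Y).filter (fun z => z.1 * z.2 = g)).image Prod.fst,
          a ^ (x.norm + (x⁻¹ * g).norm) := by
        refine (Finset.sum_image (f := fun x => a ^ (x.norm + (x⁻¹ * g).norm)) ?_).symm
        intro z hz z' hz' h
        have e1 := (Finset.mem_filter.1 (Finset.mem_coe.1 hz)).2
        have e2 := (Finset.mem_filter.1 (Finset.mem_coe.1 hz')).2
        refine Prod.ext h ?_
        rw [← e2, h] at e1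
        exact mul_left_cancel e1
    _ ≤ ∑ x ∈ ball n N, a ^ (x.norm + (x⁻¹ * g).norm) := by
        refine Finset.sum_le_sum_of_subset_of_nonneg ?_ fun _ _ _ => by positivity
        intro x hx
        obtain ⟨z, hz, rfl⟩ := Finset.mem_image.1 hx
        exact hX (Finset.mem_product.1 (Finset.mem_filter.1 hz).1).1
    _ ≤ (N + 1) * weight (a ^ 2) (ball n N) * a ^ g.norm := sum_factorizations_le ha hg'
    _ ≤ (N + 1) * (2 * (N + 1)) * a ^ g.norm := by
        gcongr
        exact weight_sq_ball_le hn haq N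
    _ = 2 * (N + 1) ^ 2 * a ^ g.norm := by ring

end Weight

/-! ### Growth of the generated semigroup. -/

section Growth

variable {n : ℕ} {a : ℝ}

open scoped Classical Pointwise in
/-- A finite set of large weight generates a semigroup that grows at rate `a⁻¹` along a syndetic
set of lengths. -/
theorem exists_length_semigroup (hn : 2 ≤ n) (ha : 0 ≤ a)
    (haq : ((2 * n - 1 : ℕ) : ℝ) * a ^ 2 ≤ 1) {R N : ℕ} (hRN : 2 * R ≤ N)
    {Q : Finset (FreeGroup (Fin n))} (hQ : Q ⊆ ball n R)
    (hw : 4 * ((N : ℝ) + 1) ^ 2 ≤ weight a Q) : ∃ l, N - R < l ∧ l ≤ N ∧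
      1 ≤ R * ((ball n N).filter fun r => r ∈ Subsemigroup.closure (Q : Set (FreeGroup (Fin n))) ∧
        r.norm = l).card * a ^ l := by
  set S := Subsemigroup.closure (Q : Set (FreeGroup (Fin n)))
  have hQS : ∀ g ∈ Q, g ∈ S := fun g hg => Subsemigroup.subset_closure hg
  set X := (ball n (N - R)).filter (· ∈ S)
  set Y := (ball n N).filter (· ∈ S)
  have hX : X ⊆ ball n N := fun g hg => by
    have := mem_ball.1 (Finset.mem_filter.1 hg).1
    exact mem_ball.2 (by omega)
  have hXQ : X * Q ⊆ Y := by
    intro g hg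
    obtain ⟨x, hx, y, hy, rfl⟩ := Finset.mem_mul.1 hg
    obtain ⟨hx1, hx2⟩ := Finset.mem_filter.1 hx
    refine Finset.mem_filter.2 ⟨mem_ball.2 ?_, S.mul_mem hx2 (hQS y hy)⟩
    have h1 := mem_ball.1 hx1
    have h2 := mem_ball.1 (hQ hy)
    have h3 := FreeGroup.norm_mul_le x y
    omega
  have hQX : Q ⊆ X := fun g hg => by
    have := mem_ball.1 (hQ hg)
    exact Finset.mem_filter.2 ⟨mem_ball.2 (by omega), hQS g hg⟩
  have hXY : X ⊆ Y := fun g hg =>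
    Finset.mem_filter.2 ⟨hX hg, (Finset.mem_filter.1 hg).2⟩
  have hN : (0 : ℝ) ≤ N := N.cast_nonneg
  have h1 := weight_mul_le hn ha haq hX (hXQ.trans (Finset.filter_subset _ _))
  have h2 := weight_mono ha hXQ
  have h3 := weight_mono ha hQX
  have hXpos : 0 ≤ weight a X := le_trans (by positivity) (hw.trans h3)
  -- The weight of Q is twice the loss 2 (N + 1)² in the product inequality, so enlarging the radius
  -- by R doubles the weight of the semigroup.
  have h4 : 2 * weight a X ≤ weight a Y := by
    have e1 : weight a X * (4 * ((N : ℝ) + 1) ^ 2) ≤ 2 * (N + 1) ^ 2 * weight a Y :=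
      (mul_le_mul_of_nonneg_left hw hXpos).trans
        (h1.trans (mul_le_mul_of_nonneg_left h2 (by positivity)))
    have e2 : 2 * ((N : ℝ) + 1) ^ 2 * (2 * weight a X) ≤ 2 * (N + 1) ^ 2 * weight a Y := by
      linarith
    exact le_of_mul_le_mul_left e2 (by positivity)
  have h5 : 1 ≤ weight a (Y \ X) := by
    have e1 : weight a (Y \ X) + weight a X = weight a Y := Finset.sum_sdiff hXY
    have e2 : (1 : ℝ) ≤ 4 * (N + 1) ^ 2 := by nlinarith
    linarith
  -- The added weight is at least 1 and is spread over R lengths, so one of them carries at least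
  -- 1/R.
  by_contra! hcon
  have hmaps : ∀ g ∈ Y \ X, g.norm ∈ Finset.Ioc (N - R) N := by
    intro g hg
    obtain ⟨g1, g2⟩ := Finset.mem_sdiff.1 hg
    obtain ⟨g3, g4⟩ := Finset.mem_filter.1 g1
    refine Finset.mem_Ioc.2 ⟨?_, mem_ball.1 g3⟩
    by_contra hlt
    exact g2 (Finset.mem_filter.2 ⟨mem_ball.2 (by omega), g4⟩)
  have hR : 0 < R := by
    rcases Nat.eq_zero_or_pos R with h | h
    · exfalso
      rw [weight, Finset.sum_eq_zero] at h5
      · norm_num at h5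
      · intro g hg
        have := hmaps g hg
        simp [h] at this
    · exact h
  rw [weight, ← Finset.sum_fiberwise_of_maps_to hmaps] at h5
  have h6 : ∀ l ∈ Finset.Ioc (N - R) N,
      ∑ g ∈ (Y \ X).filter (fun g => g.norm = l), a ^ g.norm < 1 / R := by
    intro l hl
    rw [Finset.mem_Ioc] at hl
    have e1 := hcon l hl.1 hl.2
    have e2 : ((Y \ X).filter (fun g => g.norm = l)).card ≤
        ((ball n N).filter fun r => r ∈ S ∧ r.norm = l).card := by
      apply Finset.card_le_card
      intro g hg
      obtain ⟨g1, g2⟩ := Finset.mem_filter.1 hg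
      obtain ⟨g3, g4⟩ := Finset.mem_filter.1 (Finset.mem_sdiff.1 g1).1
      exact Finset.mem_filter.2 ⟨g3, g4, g2⟩
    rw [Finset.sum_congr rfl (g := fun _ => a ^ l) fun g hg => by
      rw [(Finset.mem_filter.1 hg).2], Finset.sum_const, nsmul_eq_mul, lt_div_iff₀ (by positivity)]
    refine lt_of_le_of_lt ?_ e1
    rw [mul_comm, ← mul_assoc]
    gcongr
  have h7 := Finset.sum_lt_sum_of_nonempty (s := Finset.Ioc (N - R) N)
    ⟨N, Finset.mem_Ioc.2 ⟨by omega, le_rfl⟩⟩ h6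
  rw [Finset.sum_const, Nat.card_Ioc, show N - (N - R) = R by omega, nsmul_eq_mul,
    mul_one_div_cancel (by positivity)] at h7
  linarith

end Growth

/-! ### Completing words to cyclically reduced ones. -/

section Caps

open FreeGroup

variable {n : ℕ}

/-- The element `a c ^ k a⁻¹`, for letters `a` and `c`. -/
def cap (a c : Fin n × Bool) (k : ℕ) : FreeGroup (Fin n) :=
  mk (a :: List.replicate k c ++ [(a.1, !a.2)])

theorem cap_inv (a c : Fin n × Bool) (k : ℕ) : (cap a c k)⁻¹ = cap a (c.1, !c.2) k := by
  simp [cap, inv_mk, invRev]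

theorem norm_cap_le (a c : Fin n × Bool) (k : ℕ) : (cap a c k).norm ≤ k + 2 :=
  norm_mk_le.trans (by simp)

/-- Any nontrivial element becomes cyclically reduced, without cancellation, after multiplication
by suitable caps. -/
theorem exists_mul_cap_mem (hn : 2 ≤ n) {r : FreeGroup (Fin n)} (hr : r ≠ 1) :
    ∃ a : Fin n × Bool, ∀ c : Fin n × Bool, c.1 ≠ a.1 → ∀ k, 1 ≤ k →
      r * cap a c k ∈ cyclicRelators n (r.norm + (k + 2)) := by
  have hw : r.toWord ≠ [] := by simpa using hr
  set x := r.toWord.head hw with hx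
  set y := r.toWord.getLast hw with hy
  -- Avoiding y⁻¹ prevents cancellation between r and the cap; avoiding x prevents it between the
  -- final a⁻¹ and the start of r. There are 2n ≥ 4 letters.
  obtain ⟨a, ha⟩ : ∃ a : Fin n × Bool, a ∉ ({x, (y.1, !y.2)} : Finset (Fin n × Bool)) := by
    by_contra! hcon
    have h1 := Finset.card_le_card fun (a : Fin n × Bool) (_ : a ∈ Finset.univ) => hcon a
    have h2 := (Finset.card_insert_le x {(y.1, !y.2)})
    simp at h1 h2
    omega
  simp only [Finset.mem_insert, Finset.mem_singleton, not_or] at ha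
  refine ⟨a, fun c hc k hk => ?_⟩
  have hya : y.1 = a.1 → y.2 = a.2 := by
    intro h
    by_contra h'
    apply ha.2
    refine Prod.ext h.symm ?_
    revert h'
    cases y.2 <;> cases a.2 <;> simp
  have hax : a.1 = x.1 → (!a.2) = x.2 := by
    intro h
    by_contra h'
    apply ha.1
    refine Prod.ext h ?_
    revert h'
    cases x.2 <;> cases a.2 <;> simp
  have hcap : IsReduced (a :: List.replicate k c ++ [(a.1, !a.2)]) := by
    obtain ⟨j, rfl⟩ := Nat.exists_eq_add_of_le' hk
    rw [List.replicate_succ, List.cons_append, List.cons_append, isReduced_cons_cons]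
    refine ⟨fun h => absurd h.symm hc, ?_⟩
    rw [← List.cons_append, ← List.replicate_succ, FreeGroup.IsReduced, List.isChain_append]
    refine ⟨List.isChain_replicate_of_rel _ fun _ => rfl, List.isChain_singleton _, ?_⟩
    intro z hz z' hz'
    rw [List.eq_of_mem_replicate (List.mem_of_mem_getLast? hz)]
    simp only [List.head?_cons, Option.mem_def, Option.some.injEq] at hz'
    subst hz'
    exact fun h => absurd h hc
  have hred : IsReduced (r.toWord ++ (a :: List.replicate k c ++ [(a.1, !a.2)])) := by
    rw [FreeGroup.IsReduced, List.isChain_append]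
    refine ⟨isReduced_toWord, hcap, ?_⟩
    intro z hz z' hz'
    rw [List.getLast?_eq_getLast_of_ne_nil hw] at hz
    simp only [List.cons_append, List.head?_cons, Option.mem_def, Option.some.injEq] at hz hz'
    subst hz hz'
    exact hya
  have hword : (r * cap a c k).toWord =
      r.toWord ++ (a :: List.replicate k c ++ [(a.1, !a.2)]) := by
    rw [← toWord_mk_of_isReduced hred, ← mul_mk, mk_toWord, cap]
  refine ⟨?_, ?_⟩
  · rw [hword, isCyclicallyReduced_iff]
    refine ⟨hred, ?_⟩
    intro z hz z' hz'
    rw [← List.append_assoc, List.getLast?_concat] at hz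
    rw [List.head?_append_of_ne_nil _ hw, List.head?_eq_some_head hw] at hz'
    simp only [Option.mem_def, Option.some.injEq] at hz hz'
    subst hz hz'
    exact hax
  · rw [hword, FreeGroup.norm]
    simp

end Caps

/-! ### Many relators that must act nontrivially. -/

section Relators

variable {V : Type u} {T : SimpleGraph V} {n : ℕ} {a : ℝ}

/-- The cyclically reduced relators of length `L` that are products of elements of `Q` followed by
the element `p`. -/
def productRelators (L : ℕ) (Q : Finset (FreeGroup (Fin n))) (p : FreeGroup (Fin n)) :
    Set (cyclicRelators n L) :=
  {c | (c : FreeGroup (Fin n)) * p⁻¹ ∈ Subsemigroup.closure (Q : Set (FreeGroup (Fin n)))}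

open scoped Classical in
theorem le_weight_of_card_le (ha : 0 ≤ a) (ha1 : a ≤ 1) {B : ℕ} (A : Set (FreeGroup (Fin n)))
    (h : (ball n B).card ≤ 4 * ((ball n (B + 1)).filter (· ∈ A)).card) :
    ((2 * n - 1 : ℕ) : ℝ) ^ B * a ^ (B + 1) / 4 ≤ weight a ((ball n (B + 1)).filter (· ∈ A)) := by
  have h1 : ((2 * n - 1 : ℕ) : ℝ) ^ B ≤ 4 * ((ball n (B + 1)).filter (· ∈ A)).card := by
    exact_mod_cast (le_card_ball n B).trans h
  have h2 : ((ball n (B + 1)).filter (· ∈ A)).card * a ^ (B + 1) ≤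
      weight a ((ball n (B + 1)).filter (· ∈ A)) := by
    rw [← nsmul_eq_mul]
    refine Finset.card_nsmul_le_sum _ _ _ fun g hg => ?_
    exact pow_le_pow_of_le_one ha ha1 (mem_ball.1 (Finset.mem_filter.1 hg).1)
  have h3 : ((2 * n - 1 : ℕ) : ℝ) ^ B * a ^ (B + 1) ≤
      4 * ((ball n (B + 1)).filter (· ∈ A)).card * a ^ (B + 1) := by gcongr
  linarith

open scoped Classical Pointwise in
/-- For an action without a fixed vertex, a finite set of large weight shrinks a half-space. -/
theorem exists_shrinking_weight (hn : 2 ≤ n) (ha : 0 ≤ a) (ha1 : a ≤ 1)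
    (haq : ((2 * n - 1 : ℕ) : ℝ) * a ^ 2 ≤ 1) {B N : ℕ} (hB : 2 * (B + 1) ≤ N)
    (hw : 4 * ((N : ℝ) + 1) ^ 2 ≤ ((2 * n - 1 : ℕ) : ℝ) ^ B * a ^ (B + 1) / 4)
    (hT : T.IsTree) (φ : FreeGroup (Fin n) →* (T ≃g T))
    (hinv : ∀ g x y, T.Adj x y → ¬ (φ g x = y ∧ φ g y = x)) (hfix : ∀ x, ∃ g, φ g x ≠ x) :
    ∃ H : Set V, ∃ Q ⊆ ball n (2 * (B + 1)), (∀ g ∈ Q, g ∈ mapsStrictly φ H H) ∧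
      4 * ((N : ℝ) + 1) ^ 2 ≤ weight a Q := by
  obtain ⟨H, h | ⟨h1, h2⟩⟩ := exists_halfSpace hT φ hinv hfix B
  · refine ⟨H, _, ?_, ?_, hw.trans (le_weight_of_card_le ha ha1 _ h)⟩
    · intro g hg
      have := mem_ball.1 (Finset.mem_filter.1 hg).1
      exact mem_ball.2 (by omega)
    · exact fun g hg => (Finset.mem_filter.1 hg).2
  -- Composing two exchanges shrinks H, which is why the radius of the ball containing Q is doubled.
  · set X := (ball n (B + 1)).filter (· ∈ mapsStrictly φ Hᶜ H)
    set Y := (ball n (B + 1)).filter (· ∈ mapsStrictly φ H Hᶜ)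
    have hXY : X * Y ⊆ ball n (2 * (B + 1)) := by
      intro g hg
      obtain ⟨x, hx, y, hy, rfl⟩ := Finset.mem_mul.1 hg
      have e1 := mem_ball.1 (Finset.mem_filter.1 hx).1
      have e2 := mem_ball.1 (Finset.mem_filter.1 hy).1
      have e3 := FreeGroup.norm_mul_le x y
      exact mem_ball.2 (by omega)
    refine ⟨H, X * Y, hXY, ?_, ?_⟩
    · intro g hg
      obtain ⟨x, hx, y, hy, rfl⟩ := Finset.mem_mul.1 hg
      exact mul_mem_mapsStrictly (Finset.mem_filter.1 hx).2 (Finset.mem_filter.1 hy).2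
    · have hmono : ∀ {M : ℕ}, M ≤ N → ball n M ⊆ ball n N := fun hM g hg =>
        mem_ball.2 ((mem_ball.1 hg).trans hM)
      have e1 := weight_mul_le hn ha haq
        ((Finset.filter_subset _ _).trans (hmono (by omega)) : X ⊆ ball n N)
        (hXY.trans (hmono hB))
      have e2 := hw.trans (le_weight_of_card_le ha ha1 _ h1)
      have e3 := hw.trans (le_weight_of_card_le ha ha1 _ h2)
      have e4 : (4 * ((N : ℝ) + 1) ^ 2) * (4 * ((N : ℝ) + 1) ^ 2) ≤
          2 * (N + 1) ^ 2 * weight a (X * Y) :=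
        (mul_le_mul e2 e3 (by positivity) (le_trans (by positivity) e2)).trans e1
      have hN : (0 : ℝ) < (N + 1) ^ 2 := by positivity
      have e5 : 2 * ((N : ℝ) + 1) ^ 2 * (8 * (N + 1) ^ 2) ≤
          2 * (N + 1) ^ 2 * weight a (X * Y) := by linarith
      have e6 := le_of_mul_le_mul_left e5 (by positivity)
      linarith

open scoped Classical in
/-- For an action without a fixed vertex, there are many relators of length `L` that act
nontrivially, forming a set determined by a subset of a small ball and one element. -/
theorem exists_productRelators (hn : 2 ≤ n) (ha : 0 ≤ a) (ha1 : a ≤ 1)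
    (haq : ((2 * n - 1 : ℕ) : ℝ) * a ^ 2 ≤ 1) {B L : ℕ} (hB : 4 * (B + 1) + 3 ≤ L)
    (hw : 4 * (L : ℝ) ^ 2 ≤ ((2 * n - 1 : ℕ) : ℝ) ^ B * a ^ (B + 1) / 4)
    (hT : T.IsTree) (φ : FreeGroup (Fin n) →* (T ≃g T))
    (hinv : ∀ g x y, T.Adj x y → ¬ (φ g x = y ∧ φ g y = x)) (hfix : ∀ x, ∃ g, φ g x ≠ x) :
    ∃ Q ⊆ ball n (2 * (B + 1)), ∃ p ∈ ball n L,
      (∀ c ∈ productRelators L Q p, ∃ x, φ (c : FreeGroup (Fin n)) x ≠ x) ∧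
      1 ≤ 4 * n * (B + 1) * Nat.card (productRelators L Q p) * a ^ (L - 3 - 2 * (B + 1)) := by
  -- Three letters are reserved for the shortest cap, a c a⁻¹.
  obtain ⟨N, rfl⟩ : ∃ N, L = N + 3 := ⟨L - 3, by omega⟩
  obtain ⟨H, Q, hQ, hQH, hQw⟩ := exists_shrinking_weight (N := N) hn ha ha1 haq (by omega)
    (le_trans (by push_cast; gcongr; norm_num) hw) hT φ hinv hfix
  obtain ⟨l, hl1, hl2, hl3⟩ := exists_length_semigroup hn ha haq (by omega) hQ hQw
  have hSP : ∀ r ∈ Subsemigroup.closure (Q : Set (FreeGroup (Fin n))), r ∈ mapsStrictly φ H H := by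
    intro r hr
    induction hr using Subsemigroup.closure_induction with
    | mem x hx => exact hQH x hx
    | mul x y _ _ hx hy => exact mul_mem_mapsStrictly hx hy
  set S := (ball n N).filter fun r =>
    r ∈ Subsemigroup.closure (Q : Set (FreeGroup (Fin n))) ∧ r.norm = l with hS
  have hletter : ∀ r : FreeGroup (Fin n), ∃ b : Fin n × Bool, r ∈ S → ∀ c : Fin n × Bool,
      c.1 ≠ b.1 → ∀ k, 1 ≤ k → r * cap b c k ∈ cyclicRelators n (l + (k + 2)) := by
    intro r
    by_cases hr : r ∈ S
    · have hr1 : r.norm = l := (Finset.mem_filter.1 hr).2.2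
      have hr2 : r ≠ 1 := fun h => by
        rw [h, FreeGroup.norm_one] at hr1
        omega
      obtain ⟨b, hb⟩ := exists_mul_cap_mem hn hr2
      exact ⟨b, fun _ => hr1 ▸ hb⟩
    · exact ⟨(⟨0, by omega⟩, true), fun h => absurd h hr⟩
  choose b hb using hletter
  -- The outer letter of the cap depends on r; pigeonhole over the 2n letters makes the suffix
  -- common to all retained words.
  obtain ⟨b₀, hb₀⟩ : ∃ b₀, S.card ≤ 2 * n * (S.filter fun r => b r = b₀).card := by
    by_contra! hcon
    have h1 := Finset.card_eq_sum_card_fiberwise (s := S) (t := Finset.univ) (f := b)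
      (fun _ _ => Finset.mem_coe.2 (Finset.mem_univ _))
    have h2 : ∑ b₀ : Fin n × Bool, 2 * n * (S.filter fun r => b r = b₀).card <
        ∑ _b₀ : Fin n × Bool, S.card :=
      Finset.sum_lt_sum_of_nonempty ⟨(⟨0, by omega⟩, true), Finset.mem_univ _⟩ fun b₀ _ => hcon b₀
    rw [← Finset.mul_sum, ← h1] at h2
    simp only [Finset.sum_const, Finset.card_univ, Fintype.card_prod, Fintype.card_fin,
      Fintype.card_bool, smul_eq_mul] at h2
    exact absurd h2 (by rw [mul_comm n 2]; exact lt_irrefl _)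
  obtain ⟨c₀, hc₀⟩ : ∃ c₀ : Fin n × Bool, c₀.1 ≠ b₀.1 := by
    have : Nontrivial (Fin n) := Fin.nontrivial_iff_two_le.2 hn
    obtain ⟨i, hi⟩ := exists_ne b₀.1
    exact ⟨(i, true), hi⟩
  obtain ⟨k, hk⟩ : ∃ k, N + 3 = l + (k + 2) ∧ 1 ≤ k := ⟨N + 1 - l, by omega, by omega⟩
  obtain ⟨c, hc, hcP⟩ : ∃ c : Fin n × Bool, c.1 ≠ b₀.1 ∧
      (cap b₀ c k)⁻¹ ∉ mapsStrictly φ H H := by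
    by_cases h : (cap b₀ c₀ k)⁻¹ ∈ mapsStrictly φ H H
    · refine ⟨(c₀.1, !c₀.2), hc₀, ?_⟩
      rw [← cap_inv, inv_inv]
      exact notMem_mapsStrictly_of_inv_mem h
    · exact ⟨c₀, hc₀, h⟩
  refine ⟨Q, hQ, cap b₀ c k, ?_, ?_, ?_⟩
  · exact mem_ball.2 ((norm_cap_le _ _ _).trans (by omega))
  · intro g hg
    by_contra! hcon
    apply hcP
    have h1 := hSP _ hg
    have h2 : φ (g : FreeGroup (Fin n)) = 1 := by
      ext x; exact hcon x
    change φ _ '' H ⊂ H at h1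
    rw [map_mul, h2, one_mul] at h1
    exact h1
  · have hcard : (S.filter fun r => b r = b₀).card ≤
        Nat.card (productRelators (N + 3) Q (cap b₀ c k)) := by
      rw [← Nat.card_eq_finsetCard]
      have hmem : ∀ r ∈ S.filter fun r => b r = b₀,
          r * cap b₀ c k ∈ cyclicRelators n (N + 3) := by
        intro r hr
        obtain ⟨h1, h2⟩ := Finset.mem_filter.1 hr
        rw [hk.1, ← h2]
        exact hb r h1 c (by rwa [h2]) k hk.2
      refine Nat.card_le_card_of_injective (fun r => ⟨⟨r.1 * cap b₀ c k, hmem r.1 r.2⟩, ?_⟩) ?_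
      · change r.1 * cap b₀ c k * (cap b₀ c k)⁻¹ ∈
          Subsemigroup.closure (Q : Set (FreeGroup (Fin n)))
        rw [mul_inv_cancel_right]
        exact (Finset.mem_filter.1 (Finset.mem_filter.1 r.2).1).2.1
      · intro r r' h
        simp only [Subtype.mk.injEq, mul_left_inj] at h
        exact Subtype.ext h
    have h1 : (S.card : ℝ) ≤ 2 * n * Nat.card (productRelators (N + 3) Q (cap b₀ c k)) := by
      exact_mod_cast hb₀.trans (Nat.mul_le_mul_left _ hcard)
    have h2 : a ^ l ≤ a ^ (N + 3 - 3 - 2 * (B + 1)) := pow_le_pow_of_le_one ha ha1 (by omega)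
    calc (1 : ℝ) ≤ (2 * (B + 1) : ℕ) * S.card * a ^ l := hl3
      _ ≤ (2 * (B + 1) : ℕ) * (2 * n * Nat.card (productRelators (N + 3) Q (cap b₀ c k))) *
          a ^ (N + 3 - 3 - 2 * (B + 1)) := by gcongr
      _ = _ := by push_cast; ring

end Relators

/-! ### The union bound over pairs (Q, p). -/

section Probability

/-- A union bound: a uniformly random tuple hits every set of a finite family of large sets with
high probability. -/
theorem one_sub_exp_le_card_div {C ι : Type*} [Finite C] [Nonempty C] (I : Finset ι)
    (A : ι → Set C) (m : ℕ) (t : ℝ) (ht : ∀ i ∈ I, t ≤ (Nat.card (A i) : ℝ) / Nat.card C)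
    (E : Set (Fin m → C)) (hE : ∀ R : Fin m → C, (∀ i ∈ I, ∃ j, R j ∈ A i) → R ∈ E) :
    1 - I.card * Real.exp (-(t * m)) ≤ (Nat.card E : ℝ) / Nat.card (Fin m → C) := by
  classical
  have hC : (0 : ℝ) < Nat.card C := by exact_mod_cast Nat.card_pos
  have hpow : (Nat.card (Fin m → C) : ℝ) = (Nat.card C : ℝ) ^ m := by
    rw [Nat.card_fun]; simp
  have hmiss : ∀ i ∈ I, (Set.ncard {R : Fin m → C | ∀ j, R j ∉ A i} : ℝ) ≤
      Real.exp (-(t * m)) * (Nat.card C : ℝ) ^ m := by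
    intro i hi
    have e1 : Set.ncard {R : Fin m → C | ∀ j, R j ∉ A i} = Nat.card ((A i)ᶜ : Set C) ^ m := by
      have e0 : Nat.card {R : Fin m → C // ∀ j, R j ∉ A i} = Nat.card (Fin m → {c // c ∉ A i}) :=
        Nat.card_congr (Equiv.subtypePiEquivPi (p := fun (_ : Fin m) (c : C) => c ∉ A i))
      rw [Nat.card_fun, Nat.card_fin] at e0
      exact e0
    have e2 : (Nat.card ((A i)ᶜ : Set C) : ℝ) = Nat.card C - Nat.card (A i) := by
      rw [eq_sub_iff_add_eq, Nat.card_coe_set_eq, Nat.card_coe_set_eq, add_comm]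
      exact_mod_cast Set.ncard_add_ncard_compl (A i)
    -- One draw misses the set with probability at most 1 - t ≤ exp(-t).
    have e3 : (Nat.card ((A i)ᶜ : Set C) : ℝ) ≤ Real.exp (-t) * Nat.card C := by
      rw [e2, ← div_le_iff₀ hC, sub_div, div_self hC.ne']
      have := Real.add_one_le_exp (-t)
      linarith [ht i hi]
    rw [e1]
    push_cast
    calc (Nat.card ((A i)ᶜ : Set C) : ℝ) ^ m ≤ (Real.exp (-t) * Nat.card C) ^ m := by gcongr
      _ = _ := by
        rw [mul_pow, ← Real.exp_nat_mul]
        congr 2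
        ring
  have hcompl : (Set.ncard Eᶜ : ℝ) ≤ I.card * (Real.exp (-(t * m)) * (Nat.card C : ℝ) ^ m) := by
    have hsub : Eᶜ ⊆ ⋃ i ∈ I, {R : Fin m → C | ∀ j, R j ∉ A i} := by
      intro R hR
      by_contra hcon
      apply hR
      apply hE
      intro i hi
      by_contra! h
      exact hcon (Set.mem_biUnion (Finset.mem_coe.2 hi) h)
    have h1 : Set.ncard Eᶜ ≤ ∑ i ∈ I, Set.ncard {R : Fin m → C | ∀ j, R j ∉ A i} :=
      (Set.ncard_le_ncard hsub (Set.toFinite _)).trans (Finset.set_ncard_biUnion_le _ _)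
    calc (Set.ncard Eᶜ : ℝ) ≤ ∑ i ∈ I, (Set.ncard {R : Fin m → C | ∀ j, R j ∉ A i} : ℝ) := by
          exact_mod_cast h1
      _ ≤ _ := by
          rw [← nsmul_eq_mul]
          exact Finset.sum_le_card_nsmul _ _ _ hmiss
  have htot : (Nat.card E : ℝ) + Set.ncard Eᶜ = (Nat.card C : ℝ) ^ m := by
    rw [← hpow, Nat.card_coe_set_eq]
    exact_mod_cast Set.ncard_add_ncard_compl E
  rw [hpow, le_div_iff₀ (by positivity)]
  linarith

theorem card_cyclicRelators_le {n : ℕ} (hn : 2 ≤ n) (L : ℕ) :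
    Nat.card (cyclicRelators n L) ≤ 2 * (2 * n - 1) ^ L := by
  refine le_trans ?_ (card_reducedWords_le hn L)
  rw [← Nat.card_eq_finsetCard]
  refine Nat.card_le_card_of_injective
    (fun c => ⟨(c : FreeGroup (Fin n)).toWord, mem_reducedWords.2 ⟨c.2.1.1, c.2.2⟩⟩) ?_
  intro c c' h
  exact Subtype.ext (FreeGroup.toWord_injective (by simpa using h))

/-- If the relators meet all the large sets of product relators, then the presented group has
property (FA). -/
theorem hasPropertyFA_of_forall_exists {n : ℕ} {d : ℝ} {L B : ℕ} {a : ℝ} (hn : 2 ≤ n)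
    (ha : 0 ≤ a) (ha1 : a ≤ 1) (haq : ((2 * n - 1 : ℕ) : ℝ) * a ^ 2 ≤ 1)
    (hB : 4 * (B + 1) + 3 ≤ L)
    (hw : 4 * (L : ℝ) ^ 2 ≤ ((2 * n - 1 : ℕ) : ℝ) ^ B * a ^ (B + 1) / 4) (R : RelatorTuple n d L)
    (hR : ∀ Q ⊆ ball n (2 * (B + 1)), ∀ p ∈ ball n L,
      1 ≤ 4 * n * (B + 1) * Nat.card (productRelators L Q p) * a ^ (L - 3 - 2 * (B + 1)) →
        ∃ i, R i ∈ productRelators L Q p) : HasPropertyFA.{u} (presentedBy R) := by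
  intro V T hT ψ hinv
  by_contra! hcon
  let π := PresentedGroup.mk (Set.range fun i => (R i : FreeGroup (Fin n)))
  have hπ : Function.Surjective π := PresentedGroup.mk_surjective _
  obtain ⟨Q, hQ, p, hp, hact, hlarge⟩ := exists_productRelators hn ha ha1 haq hB hw hT (ψ.comp π)
    (fun g => hinv (π g)) (fun x => by
      obtain ⟨g, hg⟩ := hcon x
      obtain ⟨g, rfl⟩ := hπ g
      exact ⟨g, hg⟩)
  obtain ⟨i, hi⟩ := hR Q hQ p hp hlarge
  obtain ⟨x, hx⟩ := hact _ hi
  apply hx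
  have : π (R i : FreeGroup (Fin n)) = 1 := PresentedGroup.one_of_mem ⟨i, rfl⟩
  rw [MonoidHom.comp_apply, this, map_one]
  rfl

end Probability

/-! ### Choice of parameters and limit. -/

section Asymptotics

theorem eventually_mul_pow_le_pow {κ : ℝ} (hκ : 1 < κ) (C : ℝ) (k : ℕ) :
    ∀ᶠ L : ℕ in Filter.atTop, C * (L : ℝ) ^ k ≤ κ ^ L := by
  have h := (tendsto_pow_const_div_const_pow_of_one_lt k hκ).const_mul C
  rw [mul_zero] at h
  filter_upwards [h.eventually (gt_mem_nhds one_pos)] with L hL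
  rw [← mul_div_assoc, div_lt_one (by positivity)] at hL
  exact hL.le

/-- An explicit bound for the probability of property (FA) for long relators. -/
theorem one_sub_exp_le_prob {n : ℕ} (hn : 2 ≤ n) {d q θ : ℝ} (hd0 : 0 < d) (hd1 : d < 1)
    (hq : q = 2 * n - 1) (hθ : θ = q ^ (d / 8)) {L : ℕ} (h1 : 16 ≤ d * L)
    (h2 : 4 * (L : ℝ) ^ 2 ≤ θ ^ (2 * ⌊d * L / 16⌋₊) / (4 * q))
    (h3 : 16 * n * q ^ 3 * L ≤ θ ^ L)
    (h4 : 2 * (2 * (L : ℝ) + 1) + 2 * (L + 1) + L * Real.log q + L ≤ θ ^ L) :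
    1 - Real.exp (-L) ≤ prob {R : RelatorTuple n d L | HasPropertyFA.{u} (presentedBy R)} := by
  have hn' : (2 : ℝ) ≤ n := by exact_mod_cast hn
  have hqn : ((2 * n - 1 : ℕ) : ℝ) = q := by
    rw [hq, Nat.cast_sub (by omega)]; push_cast; ring
  have hq1 : 1 < q := by rw [hq]; linarith
  have hq0 : 0 < q := by linarith
  have hθ1 : 1 < θ := by rw [hθ]; exact Real.one_lt_rpow hq1 (by positivity)
  have hθ0 : 0 < θ := by linarith
  have hL0 : (0 : ℝ) < L := by
    by_contra! h
    nlinarith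
  have hL16 : (16 : ℝ) < L := by nlinarith
  have hθpow : ∀ k : ℕ, θ ^ k = q ^ (d / 8 * k) := fun k => by
    rw [hθ, Real.rpow_mul_natCast hq0.le]
  -- the parameters of the union bound
  obtain ⟨B, hB⟩ : ∃ B, ⌊d * L / 16⌋₊ = B + 1 := by
    refine Nat.exists_eq_add_of_le' (Nat.le_floor ?_)
    push_cast; linarith
  have hBL : ((B + 1 : ℕ) : ℝ) ≤ d * L / 16 := by
    rw [← hB]; exact Nat.floor_le (by positivity)
  have hBL' : ((B + 1 : ℕ) : ℝ) ≤ L / 16 := by nlinarith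
  have hBL'' : 16 * (B + 1) ≤ L := by
    have : (16 : ℝ) * (B + 1 : ℕ) ≤ L := by linarith
    exact_mod_cast this
  rw [hB] at h2
  -- The excess θ² over 1/q gives a quarter of a ball weight about θ ^ (2 (B + 1)) / (4q), while q
  -- a² ≤ 1 only needs θ⁴ = q ^ (d/2) ≤ q.
  set a : ℝ := θ ^ 2 / q with ha_def
  have ha0 : 0 < a := by positivity
  have hθ2 : θ ^ 4 ≤ q := by
    rw [hθpow]
    calc q ^ (d / 8 * (4 : ℕ)) ≤ q ^ (1 : ℝ) :=
          Real.rpow_le_rpow_of_exponent_le hq1.le (by push_cast; linarith)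
      _ = q := Real.rpow_one q
  have haq : ((2 * n - 1 : ℕ) : ℝ) * a ^ 2 ≤ 1 := by
    rw [hqn, ha_def, div_pow, ← pow_mul, ← mul_div_assoc, div_le_one (by positivity), sq]
    exact mul_le_mul_of_nonneg_left hθ2 hq0.le
  have ha1 : a ≤ 1 := by
    rw [ha_def, div_le_one hq0]
    exact (pow_le_pow_right₀ hθ1.le (by norm_num)).trans hθ2
  have hw : 4 * (L : ℝ) ^ 2 ≤ ((2 * n - 1 : ℕ) : ℝ) ^ B * a ^ (B + 1) / 4 := by
    refine h2.trans (le_of_eq ?_)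
    rw [hqn, ha_def, div_pow, ← pow_mul, pow_succ q B]
    field_simp
  -- This keeps the number of subsets Q at exp(O(L θ ^ L)); it dictates the radius dL/16.
  have hqB : q ^ (2 * (B + 1)) ≤ θ ^ L := by
    rw [hθpow, ← Real.rpow_natCast]
    refine Real.rpow_le_rpow_of_exponent_le hq1.le ?_
    push_cast at hBL ⊢
    linarith
  -- the family of sets to be hit
  have := nonempty_cyclicRelators (show 0 < n by omega) L
  let A : Finset (FreeGroup (Fin n)) × FreeGroup (Fin n) → Set (cyclicRelators n L) := fun i =>
    productRelators L i.1 i.2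
  classical
  let I := ((ball n (2 * (B + 1))).powerset ×ˢ ball n L).filter fun i =>
    1 ≤ 4 * n * (B + 1) * Nat.card (A i) * a ^ (L - 3 - 2 * (B + 1))
  -- The factor θ ^ (3L) combines θ ^ (2L) from a and θ ^ L from the 2 (B + 1) lost letters; q ³
  -- pays for the shortest cap.
  let t : ℝ := 1 / (8 * n * L * q ^ 3 * θ ^ (3 * L))
  have hCpos : (0 : ℝ) < Nat.card (cyclicRelators n L) := by exact_mod_cast Nat.card_pos
  have hC : (Nat.card (cyclicRelators n L) : ℝ) ≤ 2 * q ^ L := by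
    rw [← hqn]
    exact_mod_cast card_cyclicRelators_le hn L
  have hapow : a ^ (L - 3 - 2 * (B + 1)) * q ^ L ≤ q ^ 3 * θ ^ (3 * L) := by
    have e1 : q ^ L = q ^ (L - 3 - 2 * (B + 1)) * (q ^ 3 * q ^ (2 * (B + 1))) := by
      rw [← pow_add, ← pow_add]; congr 1; omega
    have e2 : a ^ (L - 3 - 2 * (B + 1)) * q ^ (L - 3 - 2 * (B + 1)) =
        θ ^ (2 * (L - 3 - 2 * (B + 1))) := by
      rw [← mul_pow, ha_def, div_mul_cancel₀ _ hq0.ne', pow_mul]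
    rw [e1, ← mul_assoc, e2]
    calc θ ^ (2 * (L - 3 - 2 * (B + 1))) * (q ^ 3 * q ^ (2 * (B + 1)))
        ≤ θ ^ (2 * L) * (q ^ 3 * θ ^ L) := by
          gcongr
          · exact hθ1.le
          · omega
      _ = q ^ 3 * θ ^ (3 * L) := by ring
  have ht : ∀ i ∈ I, t ≤ (Nat.card (A i) : ℝ) / Nat.card (cyclicRelators n L) := by
    intro i hi
    have e1 := (Finset.mem_filter.1 hi).2
    rw [div_le_div_iff₀ (by positivity) hCpos, one_mul]
    have hBc : ((B : ℝ) + 1) ≤ L := by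
      push_cast at hBL'; linarith
    calc (Nat.card (cyclicRelators n L) : ℝ)
        ≤ 2 * q ^ L * (4 * n * (B + 1) * Nat.card (A i) * a ^ (L - 3 - 2 * (B + 1))) :=
          hC.trans (le_mul_of_one_le_right (by positivity) e1)
      _ = Nat.card (A i) * (8 * n * (B + 1) * (a ^ (L - 3 - 2 * (B + 1)) * q ^ L)) := by ring
      _ ≤ Nat.card (A i) * (8 * n * L * (q ^ 3 * θ ^ (3 * L))) := by gcongr
      _ = _ := by ring
  have hmain := one_sub_exp_le_card_div I A (numRelators n d L) t ht
    {R : RelatorTuple n d L | HasPropertyFA.{u} (presentedBy R)} (by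
      intro R hR
      refine hasPropertyFA_of_forall_exists hn ha0.le ha1 haq (by omega) hw R ?_
      intro Q hQ p hp hlarge
      exact hR (Q, p) (Finset.mem_filter.2
        ⟨Finset.mem_product.2 ⟨Finset.mem_powerset.2 hQ, hp⟩, hlarge⟩))
  refine le_trans ?_ hmain
  -- the size of the family
  have hI : (I.card : ℝ) ≤
      Real.exp (2 * (2 * (L : ℝ) + 1) * θ ^ L + 2 * (L + 1) + L * Real.log q) := by
    have e1 : I.card ≤ 2 ^ (ball n (2 * (B + 1))).card * (ball n L).card := by
      refine (Finset.card_filter_le _ _).trans ?_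
      rw [Finset.card_product, Finset.card_powerset]
    have e2 : ((ball n (2 * (B + 1))).card : ℝ) ≤ 2 * (2 * (L : ℝ) + 1) * θ ^ L := by
      have : ((ball n (2 * (B + 1))).card : ℝ) ≤
          2 * ((2 * (B + 1) : ℕ) + 1) * ((2 * n - 1 : ℕ) : ℝ) ^ (2 * (B + 1)) := by
        exact_mod_cast card_ball_le hn (2 * (B + 1))
      refine this.trans ?_
      rw [hqn]
      gcongr
      have : (2 * (B + 1) : ℕ) ≤ 2 * L := by omega
      exact_mod_cast this
    have e3 : ((ball n L).card : ℝ) ≤ Real.exp (2 * (L + 1) + L * Real.log q) := by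
      have : ((ball n L).card : ℝ) ≤ 2 * (L + 1) * ((2 * n - 1 : ℕ) : ℝ) ^ L := by
        exact_mod_cast card_ball_le hn L
      rw [hqn] at this
      rw [Real.exp_add, ← Real.log_pow, Real.exp_log (by positivity)]
      refine this.trans ?_
      gcongr
      linarith [Real.add_one_le_exp (2 * ((L : ℝ) + 1))]
    have e4 : (2 : ℝ) ^ (ball n (2 * (B + 1))).card ≤
        Real.exp (2 * (2 * (L : ℝ) + 1) * θ ^ L) := by
      calc (2 : ℝ) ^ (ball n (2 * (B + 1))).card
          ≤ (Real.exp 1) ^ (ball n (2 * (B + 1))).card := by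
            gcongr
            linarith [Real.add_one_le_exp (1 : ℝ)]
        _ = Real.exp ((ball n (2 * (B + 1))).card) := by
            rw [← Real.exp_nat_mul, mul_one]
        _ ≤ _ := Real.exp_le_exp.2 e2
    calc (I.card : ℝ) ≤ 2 ^ (ball n (2 * (B + 1))).card * (ball n L).card := by exact_mod_cast e1
      _ ≤ Real.exp (2 * (2 * (L : ℝ) + 1) * θ ^ L) *
          Real.exp (2 * (L + 1) + L * Real.log q) := by gcongr
      _ = _ := by rw [← Real.exp_add]; congr 1; ring
  have hθL : 1 ≤ θ ^ L := one_le_pow₀ hθ1.le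
  -- the number of relators
  have hnum : θ ^ (8 * L) / 2 ≤ numRelators n d L := by
    have e1 : (2 * (n : ℝ) - 1) ^ (d * (L : ℝ)) = θ ^ (8 * L) := by
      rw [hθpow, ← hq]; congr 1; push_cast; ring
    have e2 := Nat.lt_floor_add_one ((2 * (n : ℝ) - 1) ^ (d * (L : ℝ)))
    rw [e1] at e2
    have e3 : 2 ≤ θ ^ (8 * L) := by
      have e4 : θ ^ L ≤ θ ^ (8 * L) := pow_le_pow_right₀ hθ1.le (by omega)
      have e5 : 0 ≤ L * Real.log q := mul_nonneg hL0.le (Real.log_nonneg hq1.le)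
      linarith
    rw [numRelators, e1]
    linarith
  have htm : θ ^ (2 * L) ≤ t * numRelators n d L := by
    have e0 : 0 < t := by positivity
    calc θ ^ (2 * L) ≤ θ ^ (4 * L) := pow_le_pow_right₀ hθ1.le (by omega)
      _ ≤ t * (θ ^ (8 * L) / 2) := by
          rw [show t * (θ ^ (8 * L) / 2) =
            θ ^ (8 * L) / (16 * n * q ^ 3 * L * θ ^ (3 * L)) by simp only [t]; field_simp; norm_num,
            le_div_iff₀ (by positivity)]
          calc θ ^ (4 * L) * (16 * n * q ^ 3 * L * θ ^ (3 * L))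
              ≤ θ ^ (4 * L) * (θ ^ L * θ ^ (3 * L)) := by gcongr
            _ = θ ^ (8 * L) := by ring
      _ ≤ _ := by gcongr
  have hfinal : I.card * Real.exp (-(t * numRelators n d L)) ≤ Real.exp (-L) := by
    calc I.card * Real.exp (-(t * numRelators n d L))
        ≤ Real.exp (2 * (2 * (L : ℝ) + 1) * θ ^ L + 2 * (L + 1) + L * Real.log q) *
            Real.exp (-θ ^ (2 * L)) := by gcongr
      _ ≤ _ := by
        rw [← Real.exp_add, Real.exp_le_exp]
        have e1 : θ ^ (2 * L) = θ ^ L * θ ^ L := by ring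
        have e5 : 0 ≤ L * Real.log q := mul_nonneg hL0.le (Real.log_nonneg hq1.le)
        have e2 := mul_le_mul_of_nonneg_right h4 (by positivity : 0 ≤ θ ^ L)
        have e3 := le_mul_of_one_le_right
          (by positivity : 0 ≤ 2 * ((L : ℝ) + 1) + L * Real.log q + L) hθL
        rw [e1]
        linarith
  linarith

end Asymptotics

end RandomGroup

theorem mainTheorem4 (n : ℕ) (hn : 2 ≤ n) (d : ℝ) (hd0 : 0 < d) (hd1 : d < 1) :
    RandomGroup.WithOverwhelmingProbability n d
      (fun _ => {R | HasPropertyFA.{u} (RandomGroup.presentedBy R)}) := by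
  have hn' : (2 : ℝ) ≤ n := by exact_mod_cast hn
  obtain ⟨q, hq⟩ : ∃ q : ℝ, q = 2 * n - 1 := ⟨_, rfl⟩
  obtain ⟨θ, hθ⟩ : ∃ θ : ℝ, θ = q ^ (d / 8) := ⟨_, rfl⟩
  have hq1 : 1 < q := by rw [hq]; linarith
  have hθ1 : 1 < θ := by rw [hθ]; exact Real.one_lt_rpow hq1 (by positivity)
  have hθ0 : 0 < θ := by linarith
  have hq0 : 0 < q := by linarith
  have hlim : Filter.Tendsto (fun L : ℕ => 1 - Real.exp (-L)) Filter.atTop (nhds 1) := by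
    have := (Real.tendsto_exp_neg_atTop_nhds_zero.comp
      (tendsto_natCast_atTop_atTop (R := ℝ))).const_sub 1
    simpa using this
  refine tendsto_of_tendsto_of_tendsto_of_le_of_le' hlim tendsto_const_nhds ?_ ?_
  -- The floor in θ ^ (2⌊dL/16⌋) loses at most θ², leaving (θ ^ (d/8)) ^ L, which still outgrows L².
  · have hκ : 1 < θ ^ (d / 8) := Real.one_lt_rpow hθ1 (by positivity)
    filter_upwards [RandomGroup.eventually_mul_pow_le_pow hκ (16 * q * θ ^ 2) 2,
      RandomGroup.eventually_mul_pow_le_pow hθ1 (16 * n * q ^ 3) 1,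
      RandomGroup.eventually_mul_pow_le_pow hθ1 (11 + Real.log q) 1,
      Filter.eventually_ge_atTop ⌈16 / d⌉₊, Filter.eventually_ge_atTop 1] with L e1 e2 e3 e4 e5
    have e5' : (1 : ℝ) ≤ L := by exact_mod_cast e5
    refine RandomGroup.one_sub_exp_le_prob hn hd0 hd1 hq hθ ?_ ?_ (by simpa using e2) ?_
    · have := Nat.ceil_le.1 e4
      rwa [div_le_iff₀' hd0] at this
    · rw [le_div_iff₀ (by positivity)]
      have e6 : (θ ^ (d / 8)) ^ L ≤ θ ^ (2 * ⌊d * L / 16⌋₊) * θ ^ 2 := by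
        rw [← pow_add, ← Real.rpow_mul_natCast hθ0.le, ← Real.rpow_natCast]
        refine Real.rpow_le_rpow_of_exponent_le hθ1.le ?_
        have := Nat.lt_floor_add_one (d * L / 16)
        push_cast
        linarith
      have e7 : 0 < θ ^ 2 := by positivity
      refine le_of_mul_le_mul_right ?_ e7
      refine le_trans (le_of_eq ?_) (e1.trans e6)
      ring
    -- Here 2(2L + 1) + 2(L + 1) + L = 7L + 4 ≤ 11L, as L ≥ 1.
    · rw [pow_one] at e3
      linarith
  · refine Filter.Eventually.of_forall fun L => ?_
    have := RandomGroup.nonempty_cyclicRelators (show 0 < n by omega) L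
    refine div_le_one_of_le₀ ?_ (Nat.cast_nonneg _)
    exact_mod_cast Finite.card_subtype_le _
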